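/- Let $q\equiv 1\pmod 4$ be a prime power and let $n=\tfrac12(q+1)$. Then there exist circulant symmetric integer matrices $X,Y$ of order $n$ such that $X$ has zero diagonal and all other entries $\pm1$, $Y$ has all entries $\pm1$, and $XX^{\top}+YY^{\top}=qI$ (such matrices are due to Turyn), and for which the following holds. The matrices $A=X+I$, $B=C=Y$, $D=X-I$ are propus matrices of order $n$, that is, they are circulant symmetric matrices with entries $\pm1$ satisfying $$AA^{\top}+2BB^{\top}+DD^{\top}=4nI,$$ and the propus array $$\begin{bmatrix}A&B&B&D\\ B&D&-A&-B\\ B&-A&-D&B\\ D&-B&B&-A\end{bmatrix}$$ is a symmetric Hadamard matrix of order $4n=2(q+1)$ (a symmetric matrix $H$ with entries $\pm1$ and $HH^{\top}=H^{\top}H=2(q+1)I$). -/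

import Mathlib

open scoped Matrix

namespace Propus

/-- `M` is a circulant matrix of order `n`: each entry `M i j` depends only on `i - j` modulo `n`. -/
def IsCirculant {n : ℕ} (M : Matrix (Fin n) (Fin n) ℤ) : Prop :=
  ∃ v : Fin n → ℤ, M = Matrix.circulant v

/-- All entries of `M` are `1` or `-1`. -/
def IsSignMatrix {m : Type*} (M : Matrix m m ℤ) : Prop :=
  ∀ i j, M i j = 1 ∨ M i j = -1

/-- `A`, `B`, `C`, `D` are propus matrices of order `n`: four circulant symmetric `±1` matrices,
with `B = C`, satisfying the additive property. -/
structure IsPropus {n : ℕ} (A B C D : Matrix (Fin n) (Fin n) ℤ) : Prop where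
  sign_A : IsSignMatrix A
  sign_B : IsSignMatrix B
  sign_D : IsSignMatrix D
  circ_A : IsCirculant A
  circ_B : IsCirculant B
  circ_D : IsCirculant D
  symm_A : A.IsSymm
  symm_B : B.IsSymm
  symm_D : D.IsSymm
  eq_BC : B = C
  additive : A * Aᵀ + 2 • (B * Bᵀ) + D * Dᵀ = (4 * n : ℤ) • (1 : Matrix (Fin n) (Fin n) ℤ)

/-- The propus array, with the blocks `A`, `B`, `D` of order `n` written out as a single matrix of
order `4 * n`; the entry at row `n * k + i`, column `n * l + j` is the `(i, j)` entry of the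
`(k, l)` block. -/
def propusArray {n : ℕ} (A B D : Matrix (Fin n) (Fin n) ℤ) :
    Matrix (Fin (4 * n)) (Fin (4 * n)) ℤ :=
  Matrix.reindex finProdFinEquiv finProdFinEquiv <|
    Matrix.comp (Fin 4) (Fin 4) (Fin n) (Fin n) ℤ
      !![A,  B,  B,  D;
         B,  D, -A, -B;
         B, -A, -D,  B;
         D, -B,  B, -A]

/-- `X`, `Y` are circulant matrices as in Turyn's theorem for `q`: both symmetric and of order `n`,
`X` with zero diagonal and other entries `±1`, `Y` with entries `±1`, and `X Xᵀ + Y Yᵀ = q I`. -/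
structure IsTurynPair (q : ℕ) {n : ℕ} (X Y : Matrix (Fin n) (Fin n) ℤ) : Prop where
  circ_X : IsCirculant X
  circ_Y : IsCirculant Y
  symm_X : X.IsSymm
  symm_Y : Y.IsSymm
  diag_X : ∀ i, X i i = 0
  offDiag_X : ∀ i j, i ≠ j → X i j = 1 ∨ X i j = -1
  sign_Y : IsSignMatrix Y
  sum_eq : X * Xᵀ + Y * Yᵀ = (q : ℤ) • (1 : Matrix (Fin n) (Fin n) ℤ)

end Propus

/-!
Let `F` have `q` elements, let `a ∈ F` be a nonsquare, and let `U` be the subgroup of order `n` of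
`F(√a)ˣ`. As `n` is odd and prime to `q - 1`, the `2 n = q + 1` elements of `U ∪ √a U` represent
each point of the projective line of `F(√a)` over `F` exactly once. Writing `ψ` for a
parametrization of `U` by `ℤ/n` and `χ` for the quadratic character of `F`, the matrices `X` and `Y`
are the circulants of `χ(im ψ(i))` and `χ(re ψ(i))`. Up to the factor `q - 1`, the entry of
`X Xᵀ + Y Yᵀ` at distance `d ≠ 0` is then the sum of `χ(im z) χ(im (z ψ(d)))` over all `z` in
`F(√a)`, which vanishes because `im z` and `im (z ψ(d))` are independent linear forms in `z`.

Since `(X + 1)² + (X - 1)² = 2 X² + 2`, such a pair gives propus matrices, and the propus array, in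
which the blocks commute, squares to `A² + 2 B² + D²` times the identity.
-/

namespace Propus

section Array

variable {R S : Type*}

/-- The propus array as a `4 × 4` matrix whose blocks lie in an arbitrary type `R` with negation, so
that its algebra can be studied before the blocks are taken to be matrices. -/
def propusBlocks [Neg R] (A B D : R) : Matrix (Fin 4) (Fin 4) R :=
  !![A,  B,  B,  D;
     B,  D, -A, -B;
     B, -A, -D,  B;
     D, -B,  B, -A]

theorem propusBlocks_isSymm [Neg R] (A B D : R) : (propusBlocks A B D).IsSymm :=
  Matrix.IsSymm.ext fun i j => by fin_cases i <;> fin_cases j <;> rfl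

theorem propusBlocks_map [Neg R] [Neg S] {f : R → S} (hf : ∀ x, f (-x) = -f x) (A B D : R) :
    (propusBlocks A B D).map f = propusBlocks (f A) (f B) (f D) := by
  ext i j
  fin_cases i <;> fin_cases j <;> simp [propusBlocks, hf]

theorem propusBlocks_induction [Neg R] {P : R → Prop} (hneg : ∀ x, P x → P (-x)) {A B D : R}
    (hA : P A) (hB : P B) (hD : P D) (k l : Fin 4) : P (propusBlocks A B D k l) := by
  fin_cases k <;> fin_cases l <;> simp [propusBlocks, hA, hB, hD, hneg]

theorem propusBlocks_mul_self [Ring R] {A B D : R} (hAB : Commute A B) (hAD : Commute A D)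
    (hBD : Commute B D) :
    propusBlocks A B D * propusBlocks A B D = (A * A + 2 • (B * B) + D * D) • 1 := by
  ext k l
  fin_cases k <;> fin_cases l <;>
    simp only [propusBlocks, Matrix.mul_apply, Fin.sum_univ_four, Fin.zero_eta, Fin.mk_one,
      Fin.reduceFinMk, Matrix.of_apply, Matrix.cons_val, Matrix.cons_val_zero, Matrix.cons_val_one,
      Matrix.smul_apply, Matrix.one_apply, Fin.reduceEq, if_true, if_false, smul_eq_mul, mul_one,
      mul_zero, mul_neg, neg_mul, hAB.eq, hAD.eq, hBD.eq] <;>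
    abel

end Array

section Hadamard

variable {n : ℕ} {A B C D : Matrix (Fin n) (Fin n) ℤ}

theorem propusArray_eq_reindex_propusBlocks (A B D : Matrix (Fin n) (Fin n) ℤ) :
    propusArray A B D = Matrix.reindexRingEquiv ℤ finProdFinEquiv
      (Matrix.compRingEquiv (Fin 4) (Fin n) ℤ (propusBlocks A B D)) :=
  rfl

theorem IsSignMatrix.neg {m : Type*} {M : Matrix m m ℤ} (hM : IsSignMatrix M) :
    IsSignMatrix (-M) := fun i j => by
  rcases hM i j with h | h <;> simp [h]

theorem IsSignMatrix.isHadamard_of_isSymm {m : Type*} [Fintype m] [DecidableEq m]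
    {M : Matrix m m ℤ} (hM : IsSignMatrix M) (hsymm : M.IsSymm)
    (hsq : M * M = (Fintype.card m : ℤ) • 1) : M.IsHadamard := by
  have hstar : Mᴴ = M := by rw [Matrix.conjTranspose_eq_transpose_of_trivial, hsymm.eq]
  refine ⟨fun i j => ?_, ?_, ?_⟩
  · rcases hM i j with h | h <;> simp [h, Unitary.mem_iff]
  all_goals rw [hstar, hsq, zsmul_one]

theorem IsCirculant.commute {M N : Matrix (Fin n) (Fin n) ℤ} (hM : IsCirculant M)
    (hN : IsCirculant N) : Commute M N := by
  obtain ⟨v, rfl⟩ := hM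
  obtain ⟨w, rfl⟩ := hN
  exact Matrix.Fin.circulant_mul_comm v w

theorem isSignMatrix_propusArray (hA : IsSignMatrix A) (hB : IsSignMatrix B)
    (hD : IsSignMatrix D) : IsSignMatrix (propusArray A B D) := fun _ _ =>
  propusBlocks_induction (P := IsSignMatrix) (fun _ => IsSignMatrix.neg) hA hB hD _ _ _ _

theorem propusArray_isSymm (hA : A.IsSymm) (hB : B.IsSymm) (hD : D.IsSymm) :
    (propusArray A B D).IsSymm := by
  have hblocks : (propusBlocks A B D)ᵀ.map (·ᵀ) = propusBlocks A B D := by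
    rw [(propusBlocks_isSymm A B D).eq, propusBlocks_map Matrix.transpose_neg, hA.eq, hB.eq, hD.eq]
  have hcomp : (Matrix.comp _ _ _ _ ℤ (propusBlocks A B D)).IsSymm :=
    (Matrix.transpose_comp _).trans (congrArg _ hblocks)
  exact hcomp.reindex finProdFinEquiv

theorem propusArray_mul_self {c : ℤ} (hAB : Commute A B) (hAD : Commute A D) (hBD : Commute B D)
    (h : A * A + 2 • (B * B) + D * D = c • 1) :
    propusArray A B D * propusArray A B D = c • 1 := by
  rw [propusArray_eq_reindex_propusBlocks, ← map_mul, ← map_mul,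
    propusBlocks_mul_self hAB hAD hBD, h, smul_one_smul, map_zsmul, map_zsmul, map_one, map_one]

theorem IsPropus.isHadamard_propusArray (h : IsPropus A B C D) :
    (propusArray A B D).IsHadamard := by
  have hadd := h.additive
  rw [h.symm_A.eq, h.symm_B.eq, h.symm_D.eq] at hadd
  refine (isSignMatrix_propusArray h.sign_A h.sign_B h.sign_D).isHadamard_of_isSymm
    (propusArray_isSymm h.symm_A h.symm_B h.symm_D) ?_
  rw [propusArray_mul_self (h.circ_A.commute h.circ_B) (h.circ_A.commute h.circ_D)
    (h.circ_B.commute h.circ_D) hadd]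
  simp

end Hadamard

section TurynToPropus

variable {n : ℕ} {M N X Y : Matrix (Fin n) (Fin n) ℤ}

theorem IsCirculant.add (hM : IsCirculant M) (hN : IsCirculant N) : IsCirculant (M + N) := by
  obtain ⟨v, rfl⟩ := hM
  obtain ⟨w, rfl⟩ := hN
  exact ⟨v + w, (Matrix.circulant_add v w).symm⟩

theorem IsCirculant.sub (hM : IsCirculant M) (hN : IsCirculant N) : IsCirculant (M - N) := by
  obtain ⟨v, rfl⟩ := hM
  obtain ⟨w, rfl⟩ := hN
  exact ⟨v - w, (Matrix.circulant_sub v w).symm⟩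

theorem isCirculant_one : IsCirculant (1 : Matrix (Fin n) (Fin n) ℤ) :=
  ⟨_, (Matrix.Fin.circulant_ite ℤ n).symm⟩

theorem isSignMatrix_add_smul_one {m : Type*} [DecidableEq m] {X : Matrix m m ℤ} {ε : ℤ}
    (hε : ε = 1 ∨ ε = -1) (hdiag : ∀ i, X i i = 0)
    (hoff : ∀ i j, i ≠ j → X i j = 1 ∨ X i j = -1) : IsSignMatrix (X + ε • 1) := fun i j => by
  obtain rfl | hij := eq_or_ne i j
  · rwa [Matrix.add_apply, Matrix.smul_apply, Matrix.one_apply_eq, hdiag, zero_add, smul_eq_mul,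
      mul_one]
  · rw [Matrix.add_apply, Matrix.smul_apply, Matrix.one_apply_ne hij, smul_zero, add_zero]
    exact hoff i j hij

theorem IsTurynPair.isPropus {q : ℕ} (h : IsTurynPair q X Y) (hn : 2 * n = q + 1) :
    IsPropus (X + 1) Y Y (X - 1) where
  sign_A := by
    simpa using isSignMatrix_add_smul_one (.inl rfl) h.diag_X h.offDiag_X
  sign_B := h.sign_Y
  sign_D := by
    simpa [sub_eq_add_neg] using isSignMatrix_add_smul_one (.inr rfl) h.diag_X h.offDiag_X
  circ_A := h.circ_X.add isCirculant_one
  circ_B := h.circ_Y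
  circ_D := h.circ_X.sub isCirculant_one
  symm_A := h.symm_X.add Matrix.isSymm_one
  symm_B := h.symm_Y
  symm_D := h.symm_X.sub Matrix.isSymm_one
  eq_BC := rfl
  additive := by
    have hq : (4 * n : ℤ) = 2 * q + 2 := by lia
    calc (X + 1) * (X + 1)ᵀ + 2 • (Y * Yᵀ) + (X - 1) * (X - 1)ᵀ
        = 2 • (X * Xᵀ + Y * Yᵀ) + 2 • 1 := by
          rw [Matrix.transpose_add, Matrix.transpose_sub, Matrix.transpose_one]
          noncomm_ring
      _ = (4 * n : ℤ) • 1 := by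
          rw [h.sum_eq, hq]
          module

end TurynToPropus

section CharacterSums

open scoped LinearAlgebra.Projectivization

variable {F V : Type*} [Field F] [Fintype F] [AddCommGroup V] [Module F V]

theorem sum_comp_mul_comp_eq_zero [Fintype V] {R : Type*} [Ring R] [NoZeroDivisors R] [CharZero R]
    {f g : V →ₗ[F] F} {e : V} (hfe : f e = 0) (hge : g e ≠ 0) (φ : F → R) {χ : F → R}
    (hχ : ∑ s, χ s = 0) : ∑ x, φ (f x) * χ (g x) = 0 := by
  -- The sum is invariant under translation by multiples of `e`, so it can be averaged over them.
  have htranslate (s : F) : ∑ x, φ (f x) * χ (g x) = ∑ x, φ (f x) * χ (g x + s * g e) := by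
    rw [← Equiv.sum_comp (Equiv.addRight (s • e))]
    simp [hfe]
  have hline (r : F) : ∑ s, χ (r + s * g e) = 0 :=
    (((Equiv.mulRight₀ (g e) hge).trans (Equiv.addLeft r)).sum_comp χ).trans hχ
  have hmul : (Fintype.card F : R) * ∑ x, φ (f x) * χ (g x) = 0 := calc
    _ = ∑ s, ∑ x, φ (f x) * χ (g x + s * g e) := by
      rw [← Fintype.sum_congr _ _ htranslate]
      simp
    _ = ∑ x, φ (f x) * ∑ s, χ (g x + s * g e) := by
      rw [Finset.sum_comm]
      simp_rw [Finset.mul_sum]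
    _ = 0 := by simp [hline]
  exact (mul_eq_zero.mp hmul).resolve_left (Nat.cast_ne_zero.mpr Fintype.card_ne_zero)

variable {ι : Type*} [Fintype ι] {t : ι → V} (ht : ∀ i, t i ≠ 0)

theorem sum_eq_card_units_nsmul_sum [Fintype V] [DecidableEq F] {M : Type*} [AddCommMonoid M]
    (hbij : Function.Bijective fun i => Projectivization.mk F (t i) (ht i)) {h : V → M}
    (h_zero : h 0 = 0) (h_smul : ∀ (c : Fˣ) x, h (c • x) = h x) :
    ∑ x, h x = Fintype.card Fˣ • ∑ i, h (t i) := by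
  have hinj : Function.Injective fun p : Fˣ × ι => p.1 • t p.2 := by
    rintro ⟨c, i⟩ ⟨d, j⟩ (hcd : c • t i = d • t j)
    obtain rfl : i = j := hbij.injective <|
      (Projectivization.mk_eq_mk_iff ..).mpr ⟨c⁻¹ * d, by rw [mul_smul, ← hcd, inv_smul_smul]⟩
    have hcd' : (c : F) = d := smul_left_injective F (ht i) hcd
    rw [Units.ext hcd']
  have hrange (x : V) (hx : x ∉ Set.range fun p : Fˣ × ι => p.1 • t p.2) : h x = 0 := by
    obtain rfl : x = 0 := by
      by_contra hx0
      obtain ⟨i, hi⟩ := hbij.surjective (Projectivization.mk F x hx0)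
      obtain ⟨c, hc⟩ := (Projectivization.mk_eq_mk_iff ..).mp hi.symm
      exact hx ⟨(c, i), hc⟩
    exact h_zero
  rw [← Fintype.sum_of_injective _ hinj (fun p => h (t p.2)) h hrange
    fun p => (h_smul p.1 (t p.2)).symm, Fintype.sum_prod_type]
  simp

theorem sum_quadraticChar_mul_quadraticChar_eq_zero [Finite V] [DecidableEq F] (hF : ringChar F ≠ 2)
    (hbij : Function.Bijective fun i => Projectivization.mk F (t i) (ht i))
    {f g : V →ₗ[F] F} {e : V} (hfe : f e = 0) (hge : g e ≠ 0) :
    ∑ i, quadraticChar F (f (t i)) * quadraticChar F (g (t i)) = 0 := by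
  have := Fintype.ofFinite V
  have hV := sum_comp_mul_comp_eq_zero hfe hge (quadraticChar F) (quadraticChar_sum_zero hF)
  rw [sum_eq_card_units_nsmul_sum ht hbij (by simp)] at hV
  · exact (smul_eq_zero.mp hV).resolve_left Fintype.card_ne_zero
  · intro c x
    simp only [Units.smul_def, map_smul, smul_eq_mul, map_mul]
    rw [mul_mul_mul_comm, ← sq, quadraticChar_sq_one c.ne_zero, one_mul]

end CharacterSums

section RootsOfUnity

open QuadraticAlgebra

variable {F : Type*} [Field F] [Fintype F] {a b : F} {n : ℕ}

theorem coprime_sub_one {q : ℕ} (hnq : 2 * n = q + 1) (hn : Odd n) : n.Coprime (q - 1) := by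
  have hq : q - 1 = 2 * (n - 1) := by lia
  rw [hq]
  exact (Nat.coprime_two_right.mpr hn).mul_right <|
    (Nat.coprime_self_sub_right hn.pos).mpr (Nat.coprime_one_right n)

theorem eq_one_of_pow_eq_one_of_coprime (hn0 : n ≠ 0) (hn : n.Coprime (Fintype.card F - 1)) {x : F}
    (hx : x ^ n = 1) : x = 1 := by
  have hx0 : x ≠ 0 := (IsUnit.of_pow_eq_one hx hn0).ne_zero
  simpa [hn.gcd_eq_one] using
    pow_gcd_eq_one.mpr ⟨hx, FiniteField.pow_card_sub_one_eq_one x hx0⟩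

theorem eq_one_of_pow_eq_one_of_im_eq_zero (hn0 : n ≠ 0) (hn : n.Coprime (Fintype.card F - 1))
    {z : QuadraticAlgebra F a b} (hz : z ^ n = 1) (him : z.im = 0) : z = 1 := by
  obtain ⟨x, rfl⟩ : ∃ x : F, algebraMap F _ x = z := ⟨z.re, by ext <;> simp [him]⟩
  rw [← map_pow, ← map_one (algebraMap F _), algebraMap_inj] at hz
  rw [eq_one_of_pow_eq_one_of_coprime hn0 hn hz, map_one]

theorem norm_eq_one_of_pow_eq_one (hn0 : n ≠ 0) (hn : n.Coprime (Fintype.card F - 1))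
    {z : QuadraticAlgebra F a b} (hz : z ^ n = 1) : norm z = 1 :=
  eq_one_of_pow_eq_one_of_coprime hn0 hn (by rw [← map_pow, hz, map_one])

theorem re_ne_zero_of_pow_eq_one (hodd : Odd n) (hn : n.Coprime (Fintype.card F - 1))
    {z : QuadraticAlgebra F a 0} (hz : z ^ n = 1) : z.re ≠ 0 := by
  intro hre
  have hsq : z ^ 2 = 1 := eq_one_of_pow_eq_one_of_im_eq_zero hodd.pos.ne' hn
    (by rw [pow_right_comm, hz, one_pow]) (by simp [sq, hre])
  have hone : z = 1 := by
    simpa [(Nat.coprime_two_right.mpr hodd).gcd_eq_one] using pow_gcd_eq_one.mpr ⟨hz, hsq⟩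
  simp [hone] at hre

end RootsOfUnity

section ProjectiveLine

open QuadraticAlgebra
open scoped LinearAlgebra.Projectivization

variable {F : Type*} [Field F] {a : F} [Fact (∀ r : F, r ^ 2 ≠ a + 0 * r)]
  {A : Type*} [AddCommGroup A]

theorem addChar_pow_card {M : Type*} [Monoid M] [Fintype A] (ψ : AddChar A M) (i : A) :
    ψ i ^ Fintype.card A = 1 := by
  rw [← ψ.map_nsmul_eq_pow, card_nsmul_eq_zero, ψ.map_zero_eq_one]

theorem omega_ne_zero (a b : F) : (ω : QuadraticAlgebra F a b) ≠ 0 := fun h => by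
  simpa using congrArg im h

/-- Candidates for representatives of the points of the projective line of `F(√a)` over `F`: the
values of `ψ`, followed by their multiples by `ω = √a`. -/
def lineReps (ψ : AddChar A (QuadraticAlgebra F a 0)) : A ⊕ A → QuadraticAlgebra F a 0 :=
  Sum.elim ψ fun i => ω * ψ i

theorem lineReps_ne_zero (ψ : AddChar A (QuadraticAlgebra F a 0)) (i : A ⊕ A) :
    lineReps ψ i ≠ 0 := by
  rcases i with i | i
  · exact (ψ.val_isUnit i).ne_zero
  · exact mul_ne_zero (omega_ne_zero a 0) (ψ.val_isUnit i).ne_zero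

variable [Fintype F] [Fintype A]

theorem addChar_neg_eq_star (hcop : (Fintype.card A).Coprime (Fintype.card F - 1))
    (ψ : AddChar A (QuadraticAlgebra F a 0)) (i : A) : ψ (-i) = star (ψ i) := by
  have hnorm : ψ i * star (ψ i) = 1 := by
    rw [← algebraMap_norm_eq_mul_star, map_eq_one_iff _ algebraMap_injective,
      norm_eq_one_of_pow_eq_one Fintype.card_ne_zero hcop (addChar_pow_card ψ i)]
  rw [ψ.map_neg_eq_inv, inv_eq_of_mul_eq_one_right hnorm]

theorem addChar_im_ne_zero (hcop : (Fintype.card A).Coprime (Fintype.card F - 1))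
    {ψ : AddChar A (QuadraticAlgebra F a 0)} (hψ : Function.Injective ψ) {i : A} (hi : i ≠ 0) :
    (ψ i).im ≠ 0 := fun him =>
  hi <| hψ <| ψ.map_zero_eq_one ▸
    eq_one_of_pow_eq_one_of_im_eq_zero Fintype.card_ne_zero hcop (addChar_pow_card ψ i) him

theorem addChar_re_ne_zero (hodd : Odd (Fintype.card A))
    (hcop : (Fintype.card A).Coprime (Fintype.card F - 1))
    (ψ : AddChar A (QuadraticAlgebra F a 0)) (i : A) : (ψ i).re ≠ 0 :=
  re_ne_zero_of_pow_eq_one hodd hcop (addChar_pow_card ψ i)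

theorem lineReps_mk_injective (hodd : Odd (Fintype.card A))
    (hcop : (Fintype.card A).Coprime (Fintype.card F - 1))
    {ψ : AddChar A (QuadraticAlgebra F a 0)} (hψ : Function.Injective ψ) :
    Function.Injective fun i => Projectivization.mk F (lineReps ψ i) (lineReps_ne_zero ψ i) := by
  have hψ0 (i : A) : ψ i ≠ 0 := (ψ.val_isUnit i).ne_zero
  have hsame {c : F} {i j : A} (h : c • ψ j = ψ i) : i = j := by
    have hdiv : ψ (i - j) = algebraMap F _ c := by
      rw [ψ.map_sub_eq_div, div_eq_iff (hψ0 j), ← h, Algebra.smul_def]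
    by_contra hij
    exact addChar_im_ne_zero hcop hψ (sub_ne_zero.mpr hij) (by simp [hdiv])
  have hdiff {c : F} {i j : A} (h : c • (ω * ψ j) = ψ i) : False := by
    have hdiv : ψ (i - j) = c • ω := by
      rw [ψ.map_sub_eq_div, div_eq_iff (hψ0 j), ← h, smul_mul_assoc]
    exact addChar_re_ne_zero hodd hcop ψ (i - j) (by simp [hdiv])
  rintro (i | i) (j | j) hij
  all_goals
    obtain ⟨c, hc⟩ := (Projectivization.mk_eq_mk_iff' ..).mp hij
    simp only [lineReps, Sum.elim_inl, Sum.elim_inr] at hc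
  · rw [hsame hc]
  · exact (hdiff hc).elim
  · obtain ⟨d, hd⟩ := (Projectivization.mk_eq_mk_iff' ..).mp hij.symm
    exact (hdiff hd).elim
  · rw [← mul_smul_comm] at hc
    rw [hsame (mul_left_cancel₀ (omega_ne_zero a 0) hc)]

theorem lineReps_mk_bijective (hodd : Odd (Fintype.card A))
    (hcard : 2 * Fintype.card A = Fintype.card F + 1)
    {ψ : AddChar A (QuadraticAlgebra F a 0)} (hψ : Function.Injective ψ) :
    Function.Bijective fun i => Projectivization.mk F (lineReps ψ i) (lineReps_ne_zero ψ i) := by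
  have : Finite (QuadraticAlgebra F a 0) := Module.finite_of_finite F
  rw [Nat.bijective_iff_injective_and_card]
  refine ⟨lineReps_mk_injective hodd (coprime_sub_one hcard hodd) hψ, ?_⟩
  rw [Projectivization.card_of_finrank_two F _ (finrank_eq_two a 0), Nat.card_sum,
    Nat.card_eq_fintype_card, Nat.card_eq_fintype_card]
  lia

end ProjectiveLine

section TurynPair

open QuadraticAlgebra

variable {F : Type*} [Field F] [Fintype F] [DecidableEq F] {a : F}
  [Fact (∀ r : F, r ^ 2 ≠ a + 0 * r)] {A : Type*} [AddCommGroup A]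

theorem circulant_mul_transpose_apply {R : Type*} [NonUnitalNonAssocSemiring R] [Fintype A]
    (v : A → R) (i j : A) :
    (Matrix.circulant v * (Matrix.circulant v)ᵀ) i j = ∑ k, v k * v (k + (j - i)) := by
  simp only [Matrix.mul_apply, Matrix.transpose_apply, Matrix.circulant_apply]
  refine Fintype.sum_equiv (Equiv.subLeft i) _ _ fun k => ?_
  simp

/-- The circulant matrix of the quadratic characters of the `√a`-coordinates of the values of `ψ`,
Turyn's `X` when `ψ` parametrizes the subgroup of odd order `(|F| + 1) / 2` of `F(√a)ˣ`. -/
def turynX (ψ : AddChar A (QuadraticAlgebra F a 0)) : Matrix A A ℤ :=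
  Matrix.circulant fun i => quadraticChar F (ψ i).im

/-- The circulant matrix of the quadratic characters of the `1`-coordinates of the values of `ψ`,
Turyn's `Y` when `ψ` parametrizes the subgroup of odd order `(|F| + 1) / 2` of `F(√a)ˣ`. -/
def turynY (ψ : AddChar A (QuadraticAlgebra F a 0)) : Matrix A A ℤ :=
  Matrix.circulant fun i => quadraticChar F (ψ i).re

theorem turynX_diag (ψ : AddChar A (QuadraticAlgebra F a 0)) (i : A) : turynX ψ i i = 0 := by
  simp [turynX]

variable [Fintype A]

theorem turynX_isSymm (hneg : IsSquare (-1 : F))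
    (hcop : (Fintype.card A).Coprime (Fintype.card F - 1))
    (ψ : AddChar A (QuadraticAlgebra F a 0)) : (turynX ψ).IsSymm := by
  refine Matrix.circulant_isSymm_iff.mpr fun i => ?_
  have hχ : quadraticChar F (-1) = 1 :=
    (quadraticChar_one_iff_isSquare (neg_ne_zero.mpr one_ne_zero)).mpr hneg
  rw [addChar_neg_eq_star hcop, im_star, neg_eq_neg_one_mul, map_mul, hχ, one_mul]

theorem turynY_isSymm (hcop : (Fintype.card A).Coprime (Fintype.card F - 1))
    (ψ : AddChar A (QuadraticAlgebra F a 0)) : (turynY ψ).IsSymm := by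
  refine Matrix.circulant_isSymm_iff.mpr fun i => ?_
  rw [addChar_neg_eq_star hcop, re_star, zero_mul, add_zero]

theorem turynX_offDiag (hcop : (Fintype.card A).Coprime (Fintype.card F - 1))
    {ψ : AddChar A (QuadraticAlgebra F a 0)} (hψ : Function.Injective ψ) {i j : A} (hij : i ≠ j) :
    turynX ψ i j = 1 ∨ turynX ψ i j = -1 :=
  quadraticChar_dichotomy (addChar_im_ne_zero hcop hψ (sub_ne_zero.mpr hij))

theorem isSignMatrix_turynY (hodd : Odd (Fintype.card A))
    (hcop : (Fintype.card A).Coprime (Fintype.card F - 1))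
    (ψ : AddChar A (QuadraticAlgebra F a 0)) : IsSignMatrix (turynY ψ) := fun i j =>
  quadraticChar_dichotomy (addChar_re_ne_zero hodd hcop ψ (i - j))

theorem sum_quadraticChar_addChar_sq (hodd : Odd (Fintype.card A))
    (hcop : (Fintype.card A).Coprime (Fintype.card F - 1))
    {ψ : AddChar A (QuadraticAlgebra F a 0)} (hψ : Function.Injective ψ) :
    ∑ i, (quadraticChar F (ψ i).im ^ 2 + quadraticChar F (ψ i).re ^ 2) =
      2 * Fintype.card A - 1 := by
  classical
  have him (i : A) : quadraticChar F (ψ i).im ^ 2 = 1 - if i = 0 then 1 else 0 := by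
    split_ifs with hi
    · simp [hi]
    · rw [quadraticChar_sq_one (addChar_im_ne_zero hcop hψ hi), sub_zero]
  have hre (i : A) : quadraticChar F (ψ i).re ^ 2 = 1 :=
    quadraticChar_sq_one (addChar_re_ne_zero hodd hcop ψ i)
  simp only [him, hre, Finset.sum_add_distrib, Finset.sum_sub_distrib, Finset.sum_ite_eq',
    Finset.mem_univ, if_true, Finset.sum_const, Finset.card_univ, nsmul_one]
  ring

theorem sum_quadraticChar_addChar_mul_eq_zero (hodd : Odd (Fintype.card A))
    (hcard : 2 * Fintype.card A = Fintype.card F + 1)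
    {ψ : AddChar A (QuadraticAlgebra F a 0)} (hψ : Function.Injective ψ) {d : A} (hd : d ≠ 0) :
    ∑ i, (quadraticChar F (ψ i).im * quadraticChar F (ψ (i + d)).im +
      quadraticChar F (ψ i).re * quadraticChar F (ψ (i + d)).re) = 0 := by
  have : Finite (QuadraticAlgebra F a 0) := Module.finite_of_finite F
  have hF : ringChar F ≠ 2 := by
    rw [Ne, FiniteField.even_card_iff_char_two]
    lia
  have him_omega (z : QuadraticAlgebra F a 0) : (ω * z).im = z.re := by simp
  have hsum := sum_quadraticChar_mul_quadraticChar_eq_zero (lineReps_ne_zero ψ) hF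
    (lineReps_mk_bijective hodd hcard hψ) (f := imₗ a 0)
    (g := imₗ a 0 ∘ₗ LinearMap.mulRight F (ψ d)) (e := 1) (by simp [imₗ])
    (by simpa [imₗ] using addChar_im_ne_zero (coprime_sub_one hcard hodd) hψ hd)
  simpa only [Fintype.sum_sum_type, lineReps, Sum.elim_inl, Sum.elim_inr, LinearMap.comp_apply,
    LinearMap.mulRight_apply, imₗ, LinearMap.coe_mk, AddHom.coe_mk, mul_assoc, him_omega,
    ← ψ.map_add_eq_mul, ← Finset.sum_add_distrib] using hsum

theorem turynX_mul_transpose_add_turynY_mul_transpose [DecidableEq A]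
    (hodd : Odd (Fintype.card A)) (hcard : 2 * Fintype.card A = Fintype.card F + 1)
    {ψ : AddChar A (QuadraticAlgebra F a 0)} (hψ : Function.Injective ψ) :
    turynX ψ * (turynX ψ)ᵀ + turynY ψ * (turynY ψ)ᵀ = (Fintype.card F : ℤ) • 1 := by
  ext i j
  simp only [turynX, turynY, Matrix.add_apply, circulant_mul_transpose_apply,
    ← Finset.sum_add_distrib, Matrix.smul_apply]
  obtain rfl | hij := eq_or_ne i j
  · simp only [sub_self, add_zero, ← sq, Matrix.one_apply_eq, smul_eq_mul, mul_one]
    rw [sum_quadraticChar_addChar_sq hodd (coprime_sub_one hcard hodd) hψ]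
    lia
  · rw [Matrix.one_apply_ne hij, smul_zero,
      sum_quadraticChar_addChar_mul_eq_zero hodd hcard hψ (sub_ne_zero.mpr hij.symm)]

theorem isTurynPair_turynX_turynY {n : ℕ} [NeZero n] (hodd : Odd n)
    (hcard : 2 * n = Fintype.card F + 1) {ψ : AddChar (Fin n) (QuadraticAlgebra F a 0)}
    (hψ : Function.Injective ψ) : IsTurynPair (Fintype.card F) (turynX ψ) (turynY ψ) := by
  have hcop := coprime_sub_one hcard hodd
  have hneg : IsSquare (-1 : F) := by
    rw [FiniteField.isSquare_neg_one_iff]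
    obtain ⟨m, rfl⟩ := hodd
    lia
  rw [← Fintype.card_fin n] at hodd hcard hcop
  exact
    { circ_X := ⟨_, rfl⟩
      circ_Y := ⟨_, rfl⟩
      symm_X := turynX_isSymm hneg hcop ψ
      symm_Y := turynY_isSymm hcop ψ
      diag_X := turynX_diag ψ
      offDiag_X := fun _ _ => turynX_offDiag hcop hψ
      sign_Y := isSignMatrix_turynY hodd hcop ψ
      sum_eq := turynX_mul_transpose_add_turynY_mul_transpose hodd hcard hψ }

end TurynPair

section Existence

open QuadraticAlgebra

theorem exists_addChar_fin_injective {M : Type*} [Monoid M] {n : ℕ} [NeZero n] {ζ : M}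
    (hζ : orderOf ζ = n) : ∃ ψ : AddChar (Fin n) M, Function.Injective ψ := by
  subst hζ
  refine ⟨⟨fun i => ζ ^ (i : ℕ), by simp, fun i j => ?_⟩, fun i j hij => ?_⟩
  · rw [Fin.val_add, pow_mod_orderOf, pow_add]
  · exact Fin.ext (pow_injOn_Iio_orderOf i.is_lt j.is_lt hij)

theorem exists_orderOf_eq_of_dvd_card {G : Type*} [Group G] [Finite G] [IsCyclic G] {n : ℕ}
    (hn : n ∣ Nat.card G) : ∃ g : G, orderOf g = n := by
  obtain ⟨g, hg⟩ := IsCyclic.exists_ofOrder_eq_natCard (α := G)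
  exact ⟨_, orderOf_pow_orderOf_div (orderOf_pos g).ne' (hg ▸ hn)⟩

theorem card_quadraticAlgebra_units {F : Type*} [Field F] [Fintype F] (a b : F)
    [Fact (∀ r : F, r ^ 2 ≠ a + b * r)] :
    Nat.card (QuadraticAlgebra F a b)ˣ = (Fintype.card F + 1) * (Fintype.card F - 1) := by
  rw [Nat.card_units, Nat.card_congr (equivProd a b), Nat.card_prod, Nat.card_eq_fintype_card,
    ← Nat.sq_sub_sq, sq, one_pow]

theorem exists_isTurynPair_card (F : Type*) [Field F] [Fintype F] {n : ℕ} (hodd : Odd n)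
    (hcard : 2 * n = Fintype.card F + 1) :
    ∃ X Y : Matrix (Fin n) (Fin n) ℤ, IsTurynPair (Fintype.card F) X Y := by
  classical
  have hF : ringChar F ≠ 2 := by
    rw [Ne, FiniteField.even_card_iff_char_two]
    lia
  obtain ⟨a, ha⟩ := FiniteField.exists_nonsquare hF
  have : Fact (∀ r : F, r ^ 2 ≠ a + 0 * r) :=
    ⟨fun r hr => ha ⟨r, by rw [← sq, hr, zero_mul, add_zero]⟩⟩
  have : Finite (QuadraticAlgebra F a 0) := Module.finite_of_finite F
  have : NeZero n := ⟨hodd.pos.ne'⟩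
  have hdvd : n ∣ Nat.card (QuadraticAlgebra F a 0)ˣ := by
    rw [card_quadraticAlgebra_units, ← hcard]
    exact (dvd_mul_left n 2).mul_right _
  obtain ⟨u, hu⟩ := exists_orderOf_eq_of_dvd_card hdvd
  obtain ⟨ψ, hψ⟩ := exists_addChar_fin_injective (orderOf_units.trans hu)
  exact ⟨_, _, isTurynPair_turynX_turynY hodd hcard hψ⟩

theorem exists_isTurynPair {q n : ℕ} (hq : IsPrimePow q) (hq4 : q ≡ 1 [MOD 4])
    (hn : 2 * n = q + 1) : ∃ X Y : Matrix (Fin n) (Fin n) ℤ, IsTurynPair q X Y := by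
  obtain ⟨p, k, hp, hk, rfl⟩ := hq
  have : Fact p.Prime := ⟨hp.nat_prime⟩
  have := Fintype.ofFinite (GaloisField p k)
  have hcard : Fintype.card (GaloisField p k) = p ^ k := by
    rw [← Nat.card_eq_fintype_card, GaloisField.card p k hk.ne']
  have hodd : Odd n := by
    rw [Nat.odd_iff]
    rw [Nat.ModEq] at hq4
    lia
  rw [← hcard] at hn ⊢
  exact exists_isTurynPair_card (GaloisField p k) hodd hn

end Existence

end Propus

theorem lemma1 (q n : ℕ) (hq : IsPrimePow q) (hq4 : q ≡ 1 [MOD 4]) (hn : 2 * n = q + 1) :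
    ∃ X Y A B C D : Matrix (Fin n) (Fin n) ℤ,
      Propus.IsTurynPair q X Y ∧
      A = X + 1 ∧ B = Y ∧ C = Y ∧ D = X - 1 ∧
      Propus.IsPropus A B C D ∧
      (Propus.propusArray A B D).IsSymm ∧
      (Propus.propusArray A B D).IsHadamard ∧
      4 * n = 2 * (q + 1) := by
  obtain ⟨X, Y, h⟩ := Propus.exists_isTurynPair hq hq4 hn
  have hP := h.isPropus hn
  exact ⟨X, Y, X + 1, Y, Y, X - 1, h, rfl, rfl, rfl, rfl, hP,
    Propus.propusArray_isSymm hP.symm_A hP.symm_B hP.symm_D, hP.isHadamard_propusArray, by lia⟩
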